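/- Let $\alpha>0$, $\lambda>1/\alpha$, $\beta>0$, $\overline{\gamma}>0$. Let $\tau$ be a Gamma random variable with density $\frac{\beta^{\lambda}}{\Gamma(\lambda)}t^{\lambda-1}e^{-\beta t}$, $t>0$, and let $X,Y$ be real random variables which, conditionally on $\tau$, are independent centred Gaussians of variance $\frac{1}{2\tau}$. Put $H=(X^2+Y^2)^{1/\alpha}$ (the $\alpha$-Lomax fading variable) and let $\mathbf{\Gamma}=\overline{\gamma}\,H/\mathbb{E}[H]$ be the instantaneous SNR with average $\overline{\gamma}$. Put $$\zeta=\left(\frac{\Gamma(1+\frac1\alpha)\,\Gamma(\lambda-\frac1\alpha)}{\Gamma(\lambda)}\right)^{\alpha}.$$ Then $\mathbf{\Gamma}$ has the probability density $$f_{\mathbf\Gamma}(\gamma)=\frac{\alpha\lambda\zeta}{\overline{\gamma}^{\alpha}}\,\gamma^{\alpha-1}\left(1+\frac{\zeta}{\overline{\gamma}^{\alpha}}\gamma^{\alpha}\right)^{-(\lambda+1)}\quad(\gamma>0),\qquad f_{\mathbf\Gamma}(\gamma)=0\quad(\gamma\le 0),$$ and for every integer $n\ge 0$ and every real $s>0$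 its generalized moment generating function $\mathcal{M}^{n}_{\mathbf\Gamma}(s)=\int_0^\infty \gamma^{n} f_{\mathbf\Gamma}(\gamma)e^{-s\gamma}\,d\gamma$ converges and $$\mathcal{M}^{n}_{\mathbf\Gamma}(s)=\frac{\alpha}{s^{n}\,\Gamma(\lambda)}\;\mathsf{H}^{1,2}_{2,1}\!\left[\frac{\zeta}{\overline{\gamma}^{\alpha}s^{\alpha}}\,\middle|\,\begin{matrix}(1-\lambda,1),(1-n,\alpha)\\(1,1)\end{matrix}\right].$$ Here $\mathsf{H}^{m,k}_{p,q}$ is the Fox H-function $$\mathsf{H}^{m,k}_{p,q}\!\left[z\,\middle|\,\begin{matrix}(a_1,A_1),\dots,(a_p,A_p)\\(b_1,B_1),\dots,(b_q,B_q)\end{matrix}\right]=\frac{1}{2\pi i}\int_{L}\frac{\prod_{j\le m}\Gamma(b_j+B_ju)\,\prod_{i\le k}\Gamma(1-a_i-A_iu)}{\prod_{i>k}\Gamma(a_i+A_iu)\,\prod_{j>m}\Gamma(1-b_j-B_ju)}\,z^{-u}\,du,$$ where $L$ is a vertical line, directed upwards, that separates the poles of the $\Gamma(b_j+B_ju)$,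 $j\le m$ (on its left), from those of the $\Gamma(1-a_i-A_iu)$, $i\le k$ (on its right). For the parameters above such lines exist, and along each of them the integral converges absolutely and has the same value. -/

import Mathlib

open MeasureTheory ProbabilityTheory

noncomputable section

namespace AlphaLomax

/-! ### The Fox H-function -/

/-- The Mellin–Barnes kernel of the Fox function `H^{m,n}_{p,q}` with upper parameters
`(a i, A i)`, `i < p`, and lower parameters `(b j, B j)`, `j < q`:
`∏_{j<m} Γ(b_j + B_j s) ∏_{i<n} Γ(1 - a_i - A_i s) /
  (∏_{i≥n} Γ(a_i + A_i s) ∏_{j≥m} Γ(1 - b_j - B_j s))`. -/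
def foxKernel (m n : ℕ) {p q : ℕ} (a : Fin p → ℂ) (A : Fin p → ℝ) (b : Fin q → ℂ) (B : Fin q → ℝ)
    (s : ℂ) : ℂ :=
  ((∏ j : Fin q with j.val < m, Complex.Gamma (b j + B j * s)) *
      ∏ i : Fin p with i.val < n, Complex.Gamma (1 - a i - A i * s)) /
    ((∏ i : Fin p with n ≤ i.val, Complex.Gamma (a i + A i * s)) *
      ∏ j : Fin q with m ≤ j.val, Complex.Gamma (1 - b j - B j * s))

/-- The poles of the factors `Γ(b_j + B_j s)`, `j < m`. -/
def leftPoles (m : ℕ) {q : ℕ} (b : Fin q → ℂ) (B : Fin q → ℝ) : Set ℂ :=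
  {s | ∃ j : Fin q, j.val < m ∧ ∃ k : ℕ, b j + B j * s = -(k : ℂ)}

/-- The poles of the factors `Γ(1 - a_i - A_i s)`, `i < n`. -/
def rightPoles (n : ℕ) {p : ℕ} (a : Fin p → ℂ) (A : Fin p → ℝ) : Set ℂ :=
  {s | ∃ i : Fin p, i.val < n ∧ ∃ k : ℕ, 1 - a i - A i * s = -(k : ℂ)}

/-- The vertical line `Re s = σ` separates the left poles from the right poles. -/
def IsSeparatingLine (m n : ℕ) {p q : ℕ} (a : Fin p → ℂ) (A : Fin p → ℝ) (b : Fin q → ℂ)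
    (B : Fin q → ℝ) (σ : ℝ) : Prop :=
  (∀ s ∈ leftPoles m b B, s.re < σ) ∧ ∀ s ∈ rightPoles n a A, σ < s.re

/-- The integrand `foxKernel s * z ^ (-s)` on the line `s = σ + i t`. -/
def foxIntegrand (m n : ℕ) {p q : ℕ} (a : Fin p → ℂ) (A : Fin p → ℝ) (b : Fin q → ℂ)
    (B : Fin q → ℝ) (z : ℂ) (σ t : ℝ) : ℂ :=
  foxKernel m n a A b B (σ + t * Complex.I) * z ^ (-(σ + t * Complex.I))

/-- `w` is the value at `z` of the Fox function `H^{m,n}_{p,q}`: some vertical line separates the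
two families of poles, and along every such line `(1 / (2 π i)) ∫ foxKernel s * z ^ (-s) ds`
converges absolutely and equals `w` (on `s = σ + i t` one has `ds = i dt`). -/
def HasFoxH (m n : ℕ) {p q : ℕ} (a : Fin p → ℂ) (A : Fin p → ℝ) (b : Fin q → ℂ) (B : Fin q → ℝ)
    (z w : ℂ) : Prop :=
  (∃ σ : ℝ, IsSeparatingLine m n a A b B σ) ∧
    ∀ σ : ℝ, IsSeparatingLine m n a A b B σ →
      Integrable (foxIntegrand m n a A b B z σ) ∧
        1 / (2 * (Real.pi : ℂ)) * ∫ t : ℝ, foxIntegrand m n a A b B z σ t = w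

open Classical in
/-- The Fox H-function (with value `0` where the Mellin–Barnes integral does not define it). -/
def foxH (m n : ℕ) {p q : ℕ} (a : Fin p → ℂ) (A : Fin p → ℝ) (b : Fin q → ℂ) (B : Fin q → ℝ)
    (z : ℂ) : ℂ :=
  if h : ∃ w, HasFoxH m n a A b B z w then h.choose else 0

/-! ### The `α`-Lomax fading model -/

/-- The physical model of Lomax fading: `τ` is Gamma distributed with density
`β ^ lam / Γ(lam) * t ^ (lam - 1) * exp (-β t)`, and given `τ = t` the components `X`, `Y` are
independent centred Gaussians of variance `1 / (2 t)`. -/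
structure IsLomaxFading {Ω : Type*} [MeasurableSpace Ω] (P : Measure Ω) [IsFiniteMeasure P]
    (lam β : ℝ) (τ X Y : Ω → ℝ) : Prop where
  aemeasurable_fst : AEMeasurable X P
  aemeasurable_snd : AEMeasurable Y P
  hasLaw : HasLaw τ (gammaMeasure lam β) P
  condDistrib_eq : ∀ᵐ t ∂(P.map τ), condDistrib (fun ω => (X ω, Y ω)) τ P t =
    (gaussianReal 0 (1 / (2 * t)).toNNReal).prod (gaussianReal 0 (1 / (2 * t)).toNNReal)

/-- The `α`-Lomax variable `H = P ^ (1 / α)`, where `P = X ^ 2 + Y ^ 2` is the signal power. -/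
def fadingGain {Ω : Type*} (α : ℝ) (X Y : Ω → ℝ) (ω : Ω) : ℝ :=
  (X ω ^ 2 + Y ω ^ 2) ^ (1 / α)

/-- The instantaneous SNR `γbar * Z` with `Z = H / E[H]`. -/
def snr {Ω : Type*} [MeasurableSpace Ω] (P : Measure Ω) (α γbar : ℝ) (X Y : Ω → ℝ) (ω : Ω) : ℝ :=
  γbar * (fadingGain α X Y ω / ∫ ω', fadingGain α X Y ω' ∂P)

/-- `ζ = (Γ(1 + 1/α) Γ(lam - 1/α) / Γ(lam)) ^ α`. -/
def zeta (α lam : ℝ) : ℝ :=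
  (Real.Gamma (1 + 1 / α) * Real.Gamma (lam - 1 / α) / Real.Gamma lam) ^ α

/-- The explicit density of the instantaneous SNR, supported on `(0, ∞)`. -/
def snrPDF (α lam γbar γ : ℝ) : ℝ :=
  if 0 < γ then
    α * lam * zeta α lam / γbar ^ α * γ ^ (α - 1) *
      (1 + zeta α lam / γbar ^ α * γ ^ α) ^ (-(lam + 1))
  else 0

/-- The integrand `γ ^ n * f_G(γ) * exp (-γ s)`, where `f_G` is the density of `G`. -/
def genMGFIntegrand {Ω : Type*} [MeasurableSpace Ω] (P : Measure Ω) (G : Ω → ℝ) (n : ℕ)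
    (s γ : ℝ) : ℝ :=
  γ ^ n * (pdf G P volume γ).toReal * Real.exp (-(γ * s))

/-- The generalized moment generating function `∫_0^∞ γ ^ n f_G(γ) exp (-γ s) dγ` of a nonnegative
random variable `G` with density `f_G`. -/
def genMGF {Ω : Type*} [MeasurableSpace Ω] (P : Measure Ω) (G : Ω → ℝ) (n : ℕ) (s : ℝ) : ℝ :=
  ∫ γ in Set.Ioi 0, genMGFIntegrand P G n s γ

end AlphaLomax

end

/-! Given `τ = t`, polar coordinates show that the power `X ^ 2 + Y ^ 2` is exponential
with rate `t`, so mixing over the Gamma law of `τ` yields a Lomax law. The substitution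
`x ↦ k * x ^ (1 / α)` turns it into an `α`-Lomax law, the mean `E[H]` being a Beta integral, which
identifies the law of the SNR.

After rescaling, the generalized moment generating function is the Mellin transform at `n + α` of
`exp (-x) * (1 + z * x ^ α) ^ (-(lam + 1))`. The Beta integral is the Mellin transform of
`(1 + x) ^ (-a)`; inverting it writes the second factor as a Mellin–Barnes integral, and Fubini
lets the exponential be integrated first, producing the factor `Γ(n - α u)` of the Fox kernel.
-/

noncomputable section

namespace AlphaLomax

open Set

lemma ofReal_rpow_cpow {x : ℝ} (hx : 0 < x) (a : ℝ) (w : ℂ) :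
    ((x ^ a : ℝ) : ℂ) ^ w = (x : ℂ) ^ (a * w) := by
  have hxa : 0 < x ^ a := Real.rpow_pos_of_pos hx a
  rw [Complex.cpow_def_of_ne_zero (Complex.ofReal_ne_zero.2 hxa.ne'),
    Complex.cpow_def_of_ne_zero (Complex.ofReal_ne_zero.2 hx.ne'), ← Complex.ofReal_log hxa.le,
    ← Complex.ofReal_log hx.le, Real.log_rpow hx]
  push_cast
  ring_nf

lemma ofReal_mul_rpow_cpow {c x : ℝ} (hc : 0 < c) (hx : 0 < x) (a : ℝ) (w : ℂ) :
    ((c * x ^ a : ℝ) : ℂ) ^ w = (c : ℂ) ^ w * (x : ℂ) ^ (a * w) := by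
  rw [Complex.ofReal_mul, Complex.mul_cpow_ofReal_nonneg hc.le (Real.rpow_nonneg hx.le a),
    ofReal_rpow_cpow hx]

section MellinBarnes

variable {E : Type*} [NormedAddCommGroup E] [NormedSpace ℂ E]
  {g : ℝ → ℂ} {F : ℂ → E} {ν : ℂ} {α σ c : ℝ}

/-- The function of two variables whose integral in `t` gives the integrand of the Mellin transform
of `g x • mellinInv σ F (c * x ^ α)` at `ν`, and whose integral in `x` gives the integrand of an
inverse Mellin transform at `c`; exchanging the two integrals is the Mellin–Parseval formula. -/
def mellinKernel (g : ℝ → ℂ) (F : ℂ → E) (ν : ℂ) (α σ c x t : ℝ) : E :=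
  ((x : ℂ) ^ (ν - 1) * g x) •
    ((c * x ^ α : ℝ) : ℂ) ^ (-(σ + t * Complex.I)) • F (σ + t * Complex.I)

lemma mellinKernel_eq (hc : 0 < c) {x : ℝ} (hx : 0 < x) (t : ℝ) :
    mellinKernel g F ν α σ c x t = ((x : ℂ) ^ (ν - α * (σ + t * Complex.I) - 1) • g x) •
      (c : ℂ) ^ (-(σ + t * Complex.I)) • F (σ + t * Complex.I) := by
  have hx' : (x : ℂ) ≠ 0 := Complex.ofReal_ne_zero.2 hx.ne'
  rw [mellinKernel, ofReal_mul_rpow_cpow hc hx,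
    show ν - α * (σ + t * Complex.I) - 1 = (ν - 1) + α * -(σ + t * Complex.I) by ring,
    Complex.cpow_add _ _ hx']
  simp only [smul_smul, smul_eq_mul]
  ring_nf

lemma integrable_mellinKernel (hc : 0 < c) (hg : MellinConvergent g (ν - α * σ))
    (hF : Complex.VerticalIntegrable F σ) :
    Integrable (Function.uncurry (mellinKernel g F ν α σ c))
      ((volume.restrict (Ioi 0)).prod volume) := by
  have hprod : Integrable (fun p : ℝ × ℝ => ((p.1 : ℂ) ^ (ν - α * σ - 1) • g p.1) •
      F (σ + p.2 * Complex.I)) ((volume.restrict (Ioi 0)).prod volume) := Integrable.smul_prod hg hF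
  have hpos : ∀ᵐ p : ℝ × ℝ ∂(volume.restrict (Ioi 0)).prod volume, 0 < p.1 :=
    Measure.quasiMeasurePreserving_fst.ae (ae_restrict_mem measurableSet_Ioi)
  let φ : ℝ × ℝ → ℂ := fun p =>
    (p.1 : ℂ) ^ (-(α * p.2 * Complex.I)) * (c : ℂ) ^ (-(σ + p.2 * Complex.I))
  have hφ : ∀ᵐ p ∂(volume.restrict (Ioi 0)).prod volume, ‖φ p‖ ≤ c ^ (-σ) := by
    filter_upwards [hpos] with p hp
    simp [φ, Complex.norm_cpow_eq_rpow_re_of_pos hp, Complex.norm_cpow_eq_rpow_re_of_pos hc]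
  have hφm : Measurable φ := by fun_prop
  refine (hprod.bdd_smul _ hφm.aestronglyMeasurable hφ).congr ?_
  filter_upwards [hpos] with p hp
  have hp0 : (p.1 : ℂ) ≠ 0 := Complex.ofReal_ne_zero.2 hp.ne'
  rw [Function.uncurry, mellinKernel_eq hc hp,
    show ν - α * (σ + p.2 * Complex.I) - 1 = (ν - α * σ - 1) + -(α * p.2 * Complex.I) by ring,
    Complex.cpow_add _ _ hp0]
  simp only [φ, Pi.smul_apply', smul_smul, smul_eq_mul]
  ring_nf

lemma integral_mellinKernel_snd (x : ℝ) :
    (1 / (2 * Real.pi)) • ∫ t, mellinKernel g F ν α σ c x t =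
      (x : ℂ) ^ (ν - 1) • g x • mellinInv σ F (c * x ^ α) := by
  rw [mellinInv, smul_comm (g x), smul_comm ((x : ℂ) ^ (ν - 1)), smul_smul (_ ^ _)]
  simp only [mellinKernel, integral_smul]

lemma integral_mellinKernel_fst [CompleteSpace E] (hc : 0 < c) (t : ℝ) :
    ∫ x in Ioi 0, mellinKernel g F ν α σ c x t = (c : ℂ) ^ (-(σ + t * Complex.I)) •
      mellin g (ν - α * (σ + t * Complex.I)) • F (σ + t * Complex.I) := by
  rw [setIntegral_congr_fun measurableSet_Ioi fun x hx => mellinKernel_eq hc hx t,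
    integral_smul_const, smul_comm]
  rfl

lemma integrable_cpow_smul_mellin_smul [CompleteSpace E] (hc : 0 < c)
    (hg : MellinConvergent g (ν - α * σ)) (hF : Complex.VerticalIntegrable F σ) :
    Integrable fun t : ℝ => (c : ℂ) ^ (-(σ + t * Complex.I)) •
      mellin g (ν - α * (σ + t * Complex.I)) • F (σ + t * Complex.I) :=
  (integrable_mellinKernel hc hg hF).integral_prod_right.congr
    (.of_forall fun t => integral_mellinKernel_fst hc t)

lemma hasMellin_smul_mellinInv [CompleteSpace E] (hc : 0 < c)
    (hg : MellinConvergent g (ν - α * σ)) (hF : Complex.VerticalIntegrable F σ) :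
    HasMellin (fun x => g x • mellinInv σ F (c * x ^ α)) ν
      (mellinInv σ (fun u => mellin g (ν - α * u) • F u) c) := by
  have hint := integrable_mellinKernel hc hg hF
  refine ⟨(hint.integral_prod_left.smul (1 / (2 * Real.pi))).congr
    (.of_forall integral_mellinKernel_snd), ?_⟩
  calc mellin (fun x => g x • mellinInv σ F (c * x ^ α)) ν
    _ = (1 / (2 * Real.pi)) • ∫ x in Ioi 0, ∫ t, mellinKernel g F ν α σ c x t := by
      rw [← integral_smul]
      exact integral_congr_ae (.of_forall fun x => (integral_mellinKernel_snd x).symm)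
    _ = (1 / (2 * Real.pi)) • ∫ t, ∫ x in Ioi 0, mellinKernel g F ν α σ c x t := by
      rw [integral_integral_swap hint]
    _ = mellinInv σ (fun u => mellin g (ν - α * u) • F u) c := by
      simp only [integral_mellinKernel_fst hc]
      rfl

end MellinBarnes

lemma image_div_one_add_Ioi : (fun x : ℝ => x / (1 + x)) '' Ioi 0 = Ioo 0 1 := by
  ext y
  constructor
  · rintro ⟨x, hx, rfl⟩
    have hx : 0 < x := hx
    exact ⟨by positivity, (div_lt_one (by positivity)).2 (by linarith)⟩
  · rintro ⟨hy0, hy1⟩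
    have hy : 0 < 1 - y := sub_pos.2 hy1
    exact ⟨y / (1 - y), div_pos hy0 hy, by field_simp; ring⟩

lemma injOn_div_one_add_Ioi : InjOn (fun x : ℝ => x / (1 + x)) (Ioi 0) := by
  intro x (hx : 0 < x) y (hy : 0 < y) hxy
  rw [div_eq_div_iff (by positivity) (by positivity)] at hxy
  linarith

lemma hasDerivAt_div_one_add {x : ℝ} (hx : 0 < x) :
    HasDerivAt (fun x : ℝ => x / (1 + x)) (((1 + x) ^ 2)⁻¹) x := by
  have hx1 : 1 + x ≠ 0 := by positivity
  exact ((hasDerivAt_id' x).div ((hasDerivAt_id' x).const_add 1) hx1).congr_deriv (by ring)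

lemma betaIntegrand_div_one_add (a w : ℂ) {x : ℝ} (hx : 0 < x) :
    |((1 + x) ^ 2)⁻¹| • (((x / (1 + x) : ℝ) : ℂ) ^ (w - 1) *
      (1 - ((x / (1 + x) : ℝ) : ℂ)) ^ (a - w - 1)) =
      (x : ℂ) ^ (w - 1) • ((1 + x : ℝ) : ℂ) ^ (-a) := by
  have hx1 : 0 < 1 + x := by positivity
  have hx1' : ((1 + x : ℝ) : ℂ) ≠ 0 := Complex.ofReal_ne_zero.2 hx1.ne'
  rw [show 1 - ((x / (1 + x) : ℝ) : ℂ) = (((1 + x) ^ (-1 : ℝ) : ℝ) : ℂ) by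
      rw [Real.rpow_neg_one]; norm_cast; field_simp; ring,
    show x / (1 + x) = x * (1 + x) ^ (-1 : ℝ) by rw [Real.rpow_neg_one, div_eq_mul_inv],
    show |((1 + x) ^ 2)⁻¹| = (1 + x) ^ (-2 : ℝ) by
      rw [abs_of_pos (by positivity), Real.rpow_neg hx1.le, Real.rpow_two],
    ofReal_mul_rpow_cpow hx hx1, ofReal_rpow_cpow hx1, Complex.real_smul,
    Complex.ofReal_cpow hx1.le, smul_eq_mul, mul_assoc, mul_left_comm, ← Complex.cpow_add _ _ hx1',
    ← Complex.cpow_add _ _ hx1']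
  congr 2
  push_cast
  ring

lemma hasMellin_one_add_cpow_neg {a w : ℂ} (hw : 0 < w.re) (hwa : w.re < a.re) :
    HasMellin (fun x : ℝ => ((1 + x : ℝ) : ℂ) ^ (-a)) w
      (Complex.Gamma w * Complex.Gamma (a - w) / Complex.Gamma a) := by
  have hv : 0 < (a - w).re := by simpa using hwa
  have hderiv : ∀ x ∈ Ioi (0 : ℝ),
      HasDerivWithinAt (fun x : ℝ => x / (1 + x)) (((1 + x) ^ 2)⁻¹) (Ioi 0) x :=
    fun x hx => (hasDerivAt_div_one_add hx).hasDerivWithinAt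
  have hsubst : EqOn (fun x : ℝ => |((1 + x) ^ 2)⁻¹| • (((x / (1 + x) : ℝ) : ℂ) ^ (w - 1) *
      (1 - ((x / (1 + x) : ℝ) : ℂ)) ^ (a - w - 1)))
      (fun x : ℝ => (x : ℂ) ^ (w - 1) • ((1 + x : ℝ) : ℂ) ^ (-a)) (Ioi 0) :=
    fun x hx => betaIntegrand_div_one_add a w hx
  refine ⟨(integrableOn_congr_fun hsubst measurableSet_Ioi).1 ?_, ?_⟩
  · rw [← integrableOn_image_iff_integrableOn_abs_deriv_smul measurableSet_Ioi hderiv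
      injOn_div_one_add_Ioi (fun y : ℝ => (y : ℂ) ^ (w - 1) * (1 - (y : ℂ)) ^ (a - w - 1)),
      image_div_one_add_Ioi, ← integrableOn_Ioc_iff_integrableOn_Ioo,
      ← intervalIntegrable_iff_integrableOn_Ioc_of_le zero_le_one]
    exact Complex.betaIntegral_convergent hw hv
  · rw [mellin, ← setIntegral_congr_fun measurableSet_Ioi hsubst,
      ← integral_image_eq_integral_abs_deriv_smul measurableSet_Ioi hderiv
      injOn_div_one_add_Ioi (fun y : ℝ => (y : ℂ) ^ (w - 1) * (1 - (y : ℂ)) ^ (a - w - 1)),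
      image_div_one_add_Ioi, ← integral_Ioc_eq_integral_Ioo,
      ← intervalIntegral.integral_of_le zero_le_one]
    exact (Complex.betaIntegral_eq_Gamma_mul_div w (a - w) hw hv).trans (by rw [add_sub_cancel])

lemma integral_rpow_mul_one_add_rpow_neg {p q : ℝ} (hp : 0 < p) (hpq : p < q) :
    ∫ x in Ioi 0, x ^ (p - 1) * (1 + x) ^ (-q) =
      Real.Gamma p * Real.Gamma (q - p) / Real.Gamma q := by
  have hmellin : mellin (fun x : ℝ => ((1 + x : ℝ) : ℂ) ^ (-(q : ℂ))) p =
      Complex.Gamma p * Complex.Gamma (q - p) / Complex.Gamma q :=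
    (hasMellin_one_add_cpow_neg (by simpa using hp) (by simpa using hpq)).2
  rw [← Complex.ofReal_inj, ← integral_complex_ofReal]
  push_cast [← Complex.Gamma_ofReal]
  rw [← hmellin]
  refine setIntegral_congr_fun measurableSet_Ioi fun x (hx : 0 < x) => ?_
  simp [Complex.ofReal_cpow hx.le, Complex.ofReal_cpow (show 0 ≤ 1 + x by positivity)]

section Gamma

variable {s a : ℂ} {σ : ℝ}

lemma norm_Gamma_le_Gamma_re (hs : 0 < s.re) : ‖Complex.Gamma s‖ ≤ Real.Gamma s.re := by
  rw [Complex.Gamma_eq_integral hs, Real.Gamma_eq_integral hs, Complex.GammaIntegral]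
  refine (norm_integral_le_integral_norm _).trans_eq
    (setIntegral_congr_fun measurableSet_Ioi fun x hx => ?_)
  simp only [norm_mul, Complex.norm_real, Complex.norm_cpow_eq_rpow_re_of_pos hx,
    Real.norm_eq_abs, Real.abs_exp, Complex.sub_re, Complex.one_re]

lemma norm_Gamma_le_div_norm_sq (hs : 0 < s.re) :
    ‖Complex.Gamma s‖ ≤ Real.Gamma (s.re + 2) / ‖s‖ ^ 2 := by
  have hs0 : s ≠ 0 := fun h => by simp [h] at hs
  have hs1 : s + 1 ≠ 0 := fun h => by
    have := congrArg Complex.re h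
    simp only [Complex.add_re, Complex.one_re, Complex.zero_re] at this
    linarith
  have hadd_two : Complex.Gamma (s + 2) = (s + 1) * (s * Complex.Gamma s) := by
    rw [← Complex.Gamma_add_one _ hs0, ← Complex.Gamma_add_one _ hs1, add_assoc, one_add_one_eq_two]
  have hnorm : ‖s‖ ≤ ‖s + 1‖ := by
    rw [← sq_le_sq₀ (norm_nonneg _) (norm_nonneg _), Complex.sq_norm, Complex.sq_norm,
      Complex.normSq_apply, Complex.normSq_apply]
    simp only [Complex.add_re, Complex.one_re, Complex.add_im, Complex.one_im]
    linarith
  rw [le_div_iff₀ (by positivity)]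
  calc ‖Complex.Gamma s‖ * ‖s‖ ^ 2 = ‖s‖ * (‖s‖ * ‖Complex.Gamma s‖) := by ring
    _ ≤ ‖s + 1‖ * (‖s‖ * ‖Complex.Gamma s‖) := by gcongr
    _ = ‖Complex.Gamma (s + 2)‖ := by rw [hadd_two, norm_mul, norm_mul]
    _ ≤ Real.Gamma (s.re + 2) := by
      simpa using norm_Gamma_le_Gamma_re (s := s + 2) (by simpa using by linarith)

lemma integrable_inv_sq_add_sq (hσ : σ ≠ 0) : Integrable fun t : ℝ => (σ ^ 2 + t ^ 2)⁻¹ := by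
  refine ((integrable_inv_one_add_sq.comp_div hσ).const_mul (σ ^ 2)⁻¹).congr
    (.of_forall fun t => ?_)
  field_simp

lemma continuousAt_Gamma_of_re_pos (hs : 0 < s.re) : ContinuousAt Complex.Gamma s := by
  refine Complex.continuousAt_Gamma s fun m hm => ?_
  simp only [hm, Complex.neg_re, Complex.natCast_re] at hs
  linarith [m.cast_nonneg (α := ℝ)]

lemma verticalIntegrable_Gamma_mul_Gamma_div_Gamma (hσ : 0 < σ) (hσa : σ < a.re) :
    Complex.VerticalIntegrable
      (fun u => Complex.Gamma u * Complex.Gamma (a - u) / Complex.Gamma a) σ := by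
  have hbound := ((integrable_inv_sq_add_sq hσ.ne').const_mul (Real.Gamma (σ + 2))).mul_const
    (Real.Gamma (a.re - σ))
  refine Integrable.div_const
    (hbound.mono' (Continuous.aestronglyMeasurable ?_) (.of_forall fun t => ?_)) _
  · refine continuous_iff_continuousAt.2 fun t => .mul ?_ ?_
    · exact (continuousAt_Gamma_of_re_pos (by simpa using hσ)).comp (by fun_prop)
    · exact (continuousAt_Gamma_of_re_pos (by simpa using hσa)).comp (by fun_prop)
  · have hleft := norm_Gamma_le_div_norm_sq (s := σ + t * Complex.I) (by simpa using hσ)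
    have hright := norm_Gamma_le_Gamma_re (s := a - (σ + t * Complex.I)) (by simpa using hσa)
    rw [norm_mul]
    refine mul_le_mul ?_ (by simpa using hright) (norm_nonneg _) ?_
    · simpa [Complex.sq_norm, Complex.normSq_add_mul_I, div_eq_mul_inv] using hleft
    · have := Real.Gamma_pos_of_pos (show 0 < σ + 2 by linarith)
      positivity

lemma mellinInv_Gamma_mul_Gamma_div_Gamma {x : ℝ} (hσ : 0 < σ) (hσa : σ < a.re) (hx : 0 < x) :
    mellinInv σ (fun u => Complex.Gamma u * Complex.Gamma (a - u) / Complex.Gamma a) x =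
      ((1 + x : ℝ) : ℂ) ^ (-a) := by
  have hmellin (t : ℝ) := hasMellin_one_add_cpow_neg (a := a) (w := σ + t * Complex.I)
    (by simpa using hσ) (by simpa using hσa)
  have hvert : Complex.VerticalIntegrable (mellin fun x : ℝ => ((1 + x : ℝ) : ℂ) ^ (-a)) σ := by
    simp only [Complex.VerticalIntegrable, (hmellin _).2]
    exact verticalIntegrable_Gamma_mul_Gamma_div_Gamma hσ hσa
  have hcont : ContinuousAt (fun x : ℝ => ((1 + x : ℝ) : ℂ) ^ (-a)) x :=
    ContinuousAt.cpow (by fun_prop) (by fun_prop) (.inl (by simpa using by linarith))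
  rw [← mellinInv_mellin_eq σ _ hx (by simpa using (hmellin 0).1) hvert hcont, mellinInv, mellinInv]
  simp only [(hmellin _).2]

end Gamma

section FoxFunction

variable {α z σ : ℝ} {a lam ν : ℂ}

lemma mellin_exp_neg (hν : 0 < ν.re) :
    mellin (fun x : ℝ => (Real.exp (-x) : ℂ)) ν = Complex.Gamma ν := by
  rw [Complex.Gamma_eq_integral hν, Complex.GammaIntegral_eq_mellin]

lemma mellinConvergent_exp_neg (hν : 0 < ν.re) :
    MellinConvergent (fun x : ℝ => (Real.exp (-x) : ℂ)) ν :=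
  (Complex.GammaIntegral_convergent hν).congr_fun (fun _ _ => mul_comm _ _) measurableSet_Ioi

lemma integrable_cpow_mul_Gamma_mul_Gamma_mul_Gamma (hz : 0 < z) (hσ : 0 < σ) (hσa : σ < a.re)
    (hσν : α * σ < ν.re) :
    Integrable fun t : ℝ => (z : ℂ) ^ (-(σ + t * Complex.I)) *
      (Complex.Gamma (ν - α * (σ + t * Complex.I)) * (Complex.Gamma (σ + t * Complex.I) *
        Complex.Gamma (a - (σ + t * Complex.I)) / Complex.Gamma a)) := by
  refine (integrable_cpow_smul_mellin_smul hz (mellinConvergent_exp_neg (by simpa using hσν))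
    (verticalIntegrable_Gamma_mul_Gamma_div_Gamma hσ hσa)).congr
    (.of_forall fun t => ?_)
  simp only [mellin_exp_neg (show 0 < (ν - α * (σ + t * Complex.I)).re by simpa using hσν),
    smul_eq_mul]

lemma hasMellin_exp_neg_mul_one_add_cpow_neg (hz : 0 < z) (hσ : 0 < σ) (hσa : σ < a.re)
    (hσν : α * σ < ν.re) :
    HasMellin (fun x : ℝ => (Real.exp (-x) : ℂ) * ((1 + z * x ^ α : ℝ) : ℂ) ^ (-a)) ν
      (mellinInv σ (fun u => Complex.Gamma (ν - α * u) *
        (Complex.Gamma u * Complex.Gamma (a - u) / Complex.Gamma a)) z) := by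
  have hparseval := hasMellin_smul_mellinInv (α := α) (ν := ν) hz
    (mellinConvergent_exp_neg (by simpa using hσν))
    (verticalIntegrable_Gamma_mul_Gamma_div_Gamma hσ hσa)
  have hinv : EqOn (fun x : ℝ => (x : ℂ) ^ (ν - 1) • (Real.exp (-x) : ℂ) • mellinInv σ
        (fun u => Complex.Gamma u * Complex.Gamma (a - u) / Complex.Gamma a) (z * x ^ α))
      (fun x : ℝ => (x : ℂ) ^ (ν - 1) •
        ((Real.exp (-x) : ℂ) * ((1 + z * x ^ α : ℝ) : ℂ) ^ (-a))) (Ioi 0) := by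
    intro x (hx : 0 < x)
    simp only [mellinInv_Gamma_mul_Gamma_div_Gamma hσ hσa (show 0 < z * x ^ α by positivity),
      smul_eq_mul]
  refine ⟨hparseval.1.congr_fun hinv measurableSet_Ioi, ?_⟩
  rw [mellin, ← setIntegral_congr_fun measurableSet_Ioi hinv]
  refine hparseval.2.trans ?_
  simp only [mellinInv, smul_eq_mul]
  congr 2 with t
  rw [mellin_exp_neg (by simpa using hσν)]

lemma foxKernel_lomax (lam ν : ℂ) (α : ℝ) (u : ℂ) :
    foxKernel 1 2 ![1 - lam, 1 - ν] ![1, α] ![1] ![1] u =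
      Complex.Gamma (1 + u) * Complex.Gamma (lam - u) * Complex.Gamma (ν - α * u) := by
  have hlower : (Finset.univ.filter fun j : Fin 1 => j.val < 1) = Finset.univ := by decide
  have hlower' : (Finset.univ.filter fun j : Fin 1 => 1 ≤ j.val) = ∅ := by decide
  have hupper : (Finset.univ.filter fun j : Fin 2 => j.val < 2) = Finset.univ := by decide
  have hupper' : (Finset.univ.filter fun j : Fin 2 => 2 ≤ j.val) = ∅ := by decide
  rw [foxKernel, hlower, hlower', hupper, hupper']
  simp [Fin.prod_univ_two, mul_assoc]

lemma isSeparatingLine_lomax_iff (hα : 0 < α) :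
    IsSeparatingLine 1 2 ![1 - lam, 1 - ν] ![1, α] ![1] ![1] σ ↔
      -1 < σ ∧ σ < lam.re ∧ α * σ < ν.re := by
  have hα0 : (α : ℂ) ≠ 0 := Complex.ofReal_ne_zero.2 hα.ne'
  constructor
  · rintro ⟨hleft, hright⟩
    refine ⟨?_, ?_, ?_⟩
    · simpa using hleft (-1) ⟨0, by simp, 0, by simp⟩
    · exact hright lam ⟨0, by simp, 0, by simp⟩
    · have := hright (ν / α) ⟨1, by simp, 0, by simp [mul_div_cancel₀ _ hα0]⟩
      rwa [Complex.div_ofReal_re, lt_div_iff₀' hα] at this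
  · rintro ⟨hσ, hσlam, hσν⟩
    constructor
    · rintro u ⟨j, -, k, hk⟩
      have hre := congrArg Complex.re hk
      simp only [Matrix.cons_val_fin_one, Complex.ofReal_one, one_mul, Complex.add_re,
        Complex.one_re, Complex.neg_re, Complex.natCast_re] at hre
      linarith [k.cast_nonneg (α := ℝ)]
    · rintro u ⟨i, -, k, hk⟩
      have hre := congrArg Complex.re hk
      fin_cases i <;>
        simp only [Fin.zero_eta, Fin.mk_one, Matrix.cons_val_zero, Matrix.cons_val_one,
          Matrix.cons_val_fin_one, sub_sub_cancel, Complex.ofReal_one, one_mul, Complex.sub_re,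
          Complex.re_ofReal_mul, Complex.neg_re, Complex.natCast_re] at hre
      · linarith [k.cast_nonneg (α := ℝ)]
      · exact lt_of_mul_lt_mul_left (by linarith [k.cast_nonneg (α := ℝ)]) hα.le

lemma HasFoxH.foxH_eq {m n p q : ℕ} {a : Fin p → ℂ} {A : Fin p → ℝ} {b : Fin q → ℂ}
    {B : Fin q → ℝ} {z w : ℂ} (h : HasFoxH m n a A b B z w) : foxH m n a A b B z = w := by
  have hex : ∃ w, HasFoxH m n a A b B z w := ⟨w, h⟩
  obtain ⟨σ, hσ⟩ := h.1
  rw [foxH, dif_pos hex, ← (hex.choose_spec.2 σ hσ).2, (h.2 σ hσ).2]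

-- Moving the line by one turns `Γ(1 + u)` and `Γ(lam - u)` into the two factors of the Beta
-- integral with total exponent `lam + 1`.
lemma foxIntegrand_lomax (hz : 0 < z) (hlam : -1 < lam.re) (t : ℝ) :
    foxIntegrand 1 2 ![1 - lam, 1 - ν] ![1, α] ![1] ![1] z σ t =
      (Complex.Gamma (lam + 1) * z) * ((z : ℂ) ^ (-(((σ + 1 : ℝ) : ℂ) + t * Complex.I)) *
        (Complex.Gamma (ν + α - α * (((σ + 1 : ℝ) : ℂ) + t * Complex.I)) *
          (Complex.Gamma (((σ + 1 : ℝ) : ℂ) + t * Complex.I) *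
            Complex.Gamma (lam + 1 - (((σ + 1 : ℝ) : ℂ) + t * Complex.I)) /
              Complex.Gamma (lam + 1)))) := by
  have hz0 : (z : ℂ) ≠ 0 := Complex.ofReal_ne_zero.2 hz.ne'
  have hΓ : Complex.Gamma (lam + 1) ≠ 0 :=
    Complex.Gamma_ne_zero_of_re_pos (by simpa using by linarith)
  have hline : ((σ + 1 : ℝ) : ℂ) + t * Complex.I = 1 + (σ + t * Complex.I) := by
    push_cast
    ring
  rw [foxIntegrand, foxKernel_lomax, hline]
  generalize (σ : ℂ) + t * Complex.I = u
  rw [neg_add 1 u, Complex.cpow_add _ _ hz0, Complex.cpow_neg_one,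
    show ν + α - α * (1 + u) = ν - α * u by ring, show lam + 1 - (1 + u) = lam - u by ring]
  field_simp

lemma hasFoxH_lomax (hα : 0 < α) (hlam : -1 < lam.re) (hν : -α < ν.re) (hz : 0 < z) :
    HasFoxH 1 2 ![1 - lam, 1 - ν] ![1, α] ![1] ![1] z (Complex.Gamma (lam + 1) * z *
      mellin (fun x : ℝ => (Real.exp (-x) : ℂ) * ((1 + z * x ^ α : ℝ) : ℂ) ^ (-(lam + 1)))
        (ν + α)) := by
  refine ⟨?_, fun σ hσ => ?_⟩
  · have hν' : -1 < ν.re / α := by rwa [lt_div_iff₀ hα, neg_one_mul]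
    obtain ⟨σ, hσ, hσ'⟩ := exists_between (lt_min hlam hν')
    exact ⟨σ, (isSeparatingLine_lomax_iff hα).2
      ⟨hσ, (lt_min_iff.1 hσ').1, (lt_div_iff₀' hα).1 (lt_min_iff.1 hσ').2⟩⟩
  obtain ⟨hσ, hσlam, hσν⟩ := (isSeparatingLine_lomax_iff hα).1 hσ
  have hσ1 : 0 < σ + 1 := by linarith
  have hσlam1 : σ + 1 < (lam + 1).re := by simpa using hσlam
  have hσν1 : α * (σ + 1) < (ν + α).re := by simpa [mul_add] using hσν
  have hint := integrable_cpow_mul_Gamma_mul_Gamma_mul_Gamma hz hσ1 hσlam1 hσν1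
  refine ⟨(hint.const_mul (Complex.Gamma (lam + 1) * z)).congr
    (.of_forall fun t => (foxIntegrand_lomax hz hlam t).symm), ?_⟩
  rw [(hasMellin_exp_neg_mul_one_add_cpow_neg hz hσ1 hσlam1 hσν1).2, mellinInv]
  simp only [foxIntegrand_lomax hz hlam, smul_eq_mul, integral_const_mul, Complex.real_smul]
  push_cast
  ring

end FoxFunction

section AlphaLomaxMeasure

variable {α lam c k p : ℝ} {g : ℝ → ENNReal}

/-- The density of the `α`-Lomax distribution with shapes `α`, `lam` and scale `c ^ (-1 / α)`:
the survival function is `(1 + c * x ^ α) ^ (-lam)`. -/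
def alphaLomaxPDF (α lam c x : ℝ) : ℝ :=
  if 0 < x then α * lam * c * x ^ (α - 1) * (1 + c * x ^ α) ^ (-(lam + 1)) else 0

lemma alphaLomaxPDF_of_pos {x : ℝ} (hx : 0 < x) : alphaLomaxPDF α lam c x =
    α * lam * c * x ^ (α - 1) * (1 + c * x ^ α) ^ (-(lam + 1)) :=
  if_pos hx

lemma alphaLomaxPDF_of_nonpos {x : ℝ} (hx : x ≤ 0) : alphaLomaxPDF α lam c x = 0 :=
  if_neg hx.not_gt

@[fun_prop]
lemma measurable_alphaLomaxPDF (α lam c : ℝ) : Measurable (alphaLomaxPDF α lam c) :=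
  Measurable.ite measurableSet_Ioi (by fun_prop) measurable_const

lemma alphaLomaxPDF_nonneg (hα : 0 ≤ α) (hlam : 0 ≤ lam) (hc : 0 ≤ c) (x : ℝ) :
    0 ≤ alphaLomaxPDF α lam c x := by
  unfold alphaLomaxPDF
  split_ifs <;> positivity

lemma snrPDF_eq_alphaLomaxPDF (α lam γbar : ℝ) :
    snrPDF α lam γbar = alphaLomaxPDF α lam (zeta α lam / γbar ^ α) := by
  ext γ
  rw [snrPDF, alphaLomaxPDF, mul_div_assoc]

/-- The `α`-Lomax distribution (a Burr type XII law); `alphaLomaxMeasure 1 lam c` is the Lomax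
distribution with shape `lam` and scale `c⁻¹`. -/
def alphaLomaxMeasure (α lam c : ℝ) : Measure ℝ :=
  volume.withDensity fun x => ENNReal.ofReal (alphaLomaxPDF α lam c x)

lemma lintegral_alphaLomaxMeasure (hg : Measurable g) :
    ∫⁻ x, g x ∂(alphaLomaxMeasure α lam c) =
      ∫⁻ x in Ioi 0, ENNReal.ofReal (alphaLomaxPDF α lam c x) * g x := by
  rw [alphaLomaxMeasure, lintegral_withDensity_eq_lintegral_mul _ (by fun_prop) hg,
    ← setLIntegral_eq_of_support_subset (s := Ioi 0)]
  · simp only [Pi.mul_apply]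
  · refine Function.support_subset_iff'.2 fun x hx => ?_
    rw [Pi.mul_apply, alphaLomaxPDF_of_nonpos (notMem_Ioi.1 hx), ENNReal.ofReal_zero, zero_mul]

lemma integral_alphaLomaxMeasure (hα : 0 ≤ α) (hlam : 0 ≤ lam) (hc : 0 ≤ c) (f : ℝ → ℝ) :
    ∫ x, f x ∂(alphaLomaxMeasure α lam c) = ∫ x in Ioi 0, alphaLomaxPDF α lam c x * f x := by
  rw [alphaLomaxMeasure, integral_withDensity_eq_integral_toReal_smul (by fun_prop)
    (.of_forall fun _ => ENNReal.ofReal_lt_top),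
    setIntegral_eq_integral_of_forall_compl_eq_zero]
  · simp only [ENNReal.toReal_ofReal (alphaLomaxPDF_nonneg hα hlam hc _), smul_eq_mul]
  · intro x hx
    rw [alphaLomaxPDF_of_nonpos (notMem_Ioi.1 hx), zero_mul]

lemma lintegral_Ioi_eq_lintegral_comp_mul_rpow (hk : 0 < k) (hp : 0 < p) (g : ℝ → ENNReal) :
    ∫⁻ v in Ioi 0, g v = ∫⁻ x in Ioi 0, ENNReal.ofReal (k * p * x ^ (p - 1)) * g (k * x ^ p) := by
  have himg : (fun x : ℝ => k * x ^ p) '' Ioi 0 = Ioi 0 := by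
    refine Subset.antisymm ?_ fun v hv => ?_
    · rintro _ ⟨x, hx, rfl⟩
      exact mul_pos hk (Real.rpow_pos_of_pos hx p)
    · have hv : 0 < v / k := div_pos hv hk
      refine ⟨(v / k) ^ p⁻¹, Real.rpow_pos_of_pos hv _, ?_⟩
      simp only [Real.rpow_inv_rpow hv.le hp.ne', mul_div_cancel₀ _ hk.ne']
  have hinj : InjOn (fun x : ℝ => k * x ^ p) (Ioi 0) := fun x hx y hy h =>
    Real.rpow_left_injOn hp.ne' (mem_Ioi.1 hx).le (mem_Ioi.1 hy).le (mul_left_cancel₀ hk.ne' h)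
  have hderiv : ∀ x ∈ Ioi (0 : ℝ), HasDerivWithinAt (fun x : ℝ => k * x ^ p)
      (k * (p * x ^ (p - 1))) (Ioi 0) x := fun x hx =>
    ((Real.hasDerivAt_rpow_const (Or.inl (mem_Ioi.1 hx).ne')).const_mul k).hasDerivWithinAt
  have h := lintegral_image_eq_lintegral_abs_deriv_mul measurableSet_Ioi hderiv hinj g
  rw [himg] at h
  rw [h]
  refine setLIntegral_congr_fun measurableSet_Ioi fun x hx => ?_
  have : 0 < x ^ (p - 1) := Real.rpow_pos_of_pos hx _
  rw [abs_of_pos (by positivity), mul_assoc]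

lemma alphaLomaxPDF_mul_rpow (hk : 0 < k) (hp : 0 < p) {x : ℝ} (hx : 0 < x) :
    k * p * x ^ (p - 1) * alphaLomaxPDF α lam (c / k ^ α) (k * x ^ p) =
      alphaLomaxPDF (α * p) lam c x := by
  have hkx : 0 < k * x ^ p := by positivity
  have hpow : (k * x ^ p) ^ α = k ^ α * x ^ (α * p) := by
    rw [Real.mul_rpow hk.le (by positivity), ← Real.rpow_mul hx.le, mul_comm p]
  have hk' : 0 < k ^ α := Real.rpow_pos_of_pos hk α
  rw [alphaLomaxPDF_of_pos hx, alphaLomaxPDF_of_pos hkx, Real.rpow_sub_one hkx.ne', hpow,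
    ← mul_assoc (c / k ^ α), div_mul_cancel₀ _ hk'.ne', Real.rpow_sub_one hx.ne',
    Real.rpow_sub_one hx.ne']
  field_simp

lemma map_mul_rpow_alphaLomaxMeasure (hk : 0 < k) (hp : 0 < p) :
    (alphaLomaxMeasure (α * p) lam c).map (fun x => k * x ^ p) =
      alphaLomaxMeasure α lam (c / k ^ α) := by
  refine Measure.ext_of_lintegral _ fun g hg => ?_
  rw [lintegral_map hg (by fun_prop), lintegral_alphaLomaxMeasure (by fun_prop),
    lintegral_alphaLomaxMeasure hg, lintegral_Ioi_eq_lintegral_comp_mul_rpow hk hp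
      fun v => ENNReal.ofReal (alphaLomaxPDF α lam (c / k ^ α) v) * g v]
  refine setLIntegral_congr_fun measurableSet_Ioi fun x hx => ?_
  have hx : 0 < x := hx
  rw [← alphaLomaxPDF_mul_rpow hk hp hx, ENNReal.ofReal_mul (by positivity), mul_assoc]

lemma integral_rpow_alphaLomaxMeasure_one_one (hp : -1 < p) (hplam : p < lam) (hlam : 0 < lam) :
    ∫ x, x ^ p ∂(alphaLomaxMeasure 1 lam 1) =
      Real.Gamma (1 + p) * Real.Gamma (lam - p) / Real.Gamma lam := by
  have hpt : ∀ x ∈ Ioi (0 : ℝ), alphaLomaxPDF 1 lam 1 x * x ^ p =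
      lam * (x ^ ((1 + p) - 1) * (1 + x) ^ (-(lam + 1))) := fun x hx => by
    simp only [alphaLomaxPDF_of_pos hx, sub_self, Real.rpow_zero, Real.rpow_one, one_mul, mul_one,
      add_sub_cancel_left]
    ring
  rw [integral_alphaLomaxMeasure zero_le_one hlam.le zero_le_one,
    setIntegral_congr_fun measurableSet_Ioi hpt, integral_const_mul,
    integral_rpow_mul_one_add_rpow_neg (by linarith) (by linarith), Real.Gamma_add_one hlam.ne',
    show lam + 1 - (1 + p) = lam - p by ring]
  field_simp

lemma Gamma_one_add_mul_Gamma_sub_div_Gamma_pos (hp : 0 < p) (hplam : p < lam) :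
    0 < Real.Gamma (1 + p) * Real.Gamma (lam - p) / Real.Gamma lam :=
  div_pos (mul_pos (Real.Gamma_pos_of_pos (by linarith)) (Real.Gamma_pos_of_pos (by linarith)))
    (Real.Gamma_pos_of_pos (hp.trans hplam))

lemma zeta_pos (hα : 0 < α) (hlam : 1 / α < lam) : 0 < zeta α lam :=
  Real.rpow_pos_of_pos (Gamma_one_add_mul_Gamma_sub_div_Gamma_pos (one_div_pos.2 hα) hlam) α

lemma zeta_rpow_one_div (hα : 0 < α) (hlam : 1 / α < lam) : zeta α lam ^ (1 / α) =
    Real.Gamma (1 + 1 / α) * Real.Gamma (lam - 1 / α) / Real.Gamma lam := by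
  have hpos := Gamma_one_add_mul_Gamma_sub_div_Gamma_pos (one_div_pos.2 hα) hlam
  rw [zeta, ← Real.rpow_mul hpos.le, mul_one_div_cancel hα.ne', Real.rpow_one]

lemma integral_id_alphaLomaxMeasure (hα : 0 < α) (hlam : 1 / α < lam) (hc : 0 < c) :
    ∫ x, x ∂(alphaLomaxMeasure α lam c) = (zeta α lam / c) ^ (1 / α) := by
  have hα' : 0 < 1 / α := one_div_pos.2 hα
  have hk : 0 < (1 / c) ^ (1 / α) := by positivity
  have hmap := map_mul_rpow_alphaLomaxMeasure (α := α) (lam := lam) (c := 1) hk hα'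
  rw [mul_one_div_cancel hα.ne', one_div α, Real.rpow_inv_rpow (by positivity) hα.ne',
    one_div_one_div] at hmap
  rw [← hmap, integral_map (by fun_prop) (by fun_prop), integral_const_mul, ← one_div,
    integral_rpow_alphaLomaxMeasure_one_one (by linarith) hlam (hα'.trans hlam),
    ← zeta_rpow_one_div hα hlam, ← Real.mul_rpow (by positivity) (zeta_pos hα hlam).le,
    one_div_mul_eq_div]

end AlphaLomaxMeasure

section LomaxFading

variable {α lam β k r t : ℝ} {g : ℝ → ENNReal}

lemma ae_pos_gammaMeasure (lam β : ℝ) : ∀ᵐ t ∂(gammaMeasure lam β), 0 < t := by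
  have hmeas : Measurable (gammaPDF lam β) := (measurable_gammaPDFReal lam β).ennreal_ofReal
  rw [gammaMeasure, ae_withDensity_iff hmeas]
  filter_upwards [Measure.ae_ne volume (0 : ℝ)] with t ht h0
  exact lt_of_le_of_ne (not_lt.1 fun hlt => h0 (gammaPDF_of_neg hlt)) ht.symm

lemma lintegral_gammaMeasure (hg : Measurable g) :
    ∫⁻ x, g x ∂(gammaMeasure lam β) = ∫⁻ x in Ioi 0,
      ENNReal.ofReal (β ^ lam / Real.Gamma lam * x ^ (lam - 1) * Real.exp (-(β * x))) * g x := by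
  have hmeas : Measurable (gammaPDF lam β) := (measurable_gammaPDFReal lam β).ennreal_ofReal
  have hpos : ∀ᵐ x ∂(gammaMeasure lam β), x ∈ Ioi 0 := ae_pos_gammaMeasure lam β
  rw [← Measure.restrict_eq_self_of_ae_mem hpos, gammaMeasure,
    setLIntegral_withDensity_eq_setLIntegral_mul _ hmeas hg measurableSet_Ioi]
  refine setLIntegral_congr_fun measurableSet_Ioi fun x hx => ?_
  rw [Pi.mul_apply, gammaPDF_of_nonneg (mem_Ioi.1 hx).le]

lemma lintegral_expMeasure (hg : Measurable g) : ∫⁻ x, g x ∂(expMeasure r) =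
    ∫⁻ x in Ioi 0, ENNReal.ofReal (r * Real.exp (-(r * x))) * g x := by
  simp only [expMeasure, lintegral_gammaMeasure hg, Real.rpow_one, Real.Gamma_one, div_one,
    sub_self, Real.rpow_zero, mul_one]

lemma gaussianPDF_mul_gaussianPDF (ht : 0 < t) (x y : ℝ) :
    gaussianPDF 0 (1 / (2 * t)).toNNReal x * gaussianPDF 0 (1 / (2 * t)).toNNReal y =
      ENNReal.ofReal (t / Real.pi * Real.exp (-(t * (x ^ 2 + y ^ 2)))) := by
  rw [gaussianPDF, gaussianPDF, ← ENNReal.ofReal_mul (gaussianPDFReal_nonneg _ _ _),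
    gaussianPDFReal, gaussianPDFReal, Real.coe_toNNReal _ (by positivity), mul_mul_mul_comm,
    ← Real.exp_add, ← mul_inv, Real.mul_self_sqrt (by positivity)]
  congr 2
  · field_simp
  · congr 1; field_simp; ring

lemma polarCoord_symm_fst_sq_add_snd_sq (p : ℝ × ℝ) :
    (polarCoord.symm p).1 ^ 2 + (polarCoord.symm p).2 ^ 2 = p.1 ^ 2 := by
  rw [polarCoord_symm_apply]
  linear_combination p.1 ^ 2 * Real.sin_sq_add_cos_sq p.2

lemma lintegral_comp_sq_add_sq (hg : Measurable g) :
    ∫⁻ p : ℝ × ℝ, g (p.1 ^ 2 + p.2 ^ 2) = ENNReal.ofReal Real.pi * ∫⁻ v in Ioi 0, g v := by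
  simp only [← lintegral_comp_polarCoord_symm (fun p : ℝ × ℝ => g (p.1 ^ 2 + p.2 ^ 2)),
    polarCoord_symm_fst_sq_add_snd_sq, smul_eq_mul]
  rw [polarCoord_target, Measure.volume_eq_prod, ← Measure.prod_restrict,
    lintegral_prod _ (by fun_prop), lintegral_Ioi_eq_lintegral_comp_mul_rpow one_pos two_pos g,
    ← lintegral_const_mul _ (by fun_prop)]
  refine setLIntegral_congr_fun measurableSet_Ioi fun r _ => ?_
  simp only [lintegral_const, Measure.restrict_apply_univ, Real.volume_Ioo, one_mul, Real.rpow_two]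
  rw [mul_comm, ← mul_assoc, ← mul_assoc, ← ENNReal.ofReal_mul (by linarith [Real.pi_pos]),
    ← ENNReal.ofReal_mul Real.pi_pos.le]
  congr 2
  rw [show (2 : ℝ) - 1 = 1 by norm_num, Real.rpow_one]
  ring

lemma map_sq_add_sq_gaussianReal_prod (ht : 0 < t) :
    ((gaussianReal 0 (1 / (2 * t)).toNNReal).prod (gaussianReal 0 (1 / (2 * t)).toNNReal)).map
      (fun p => p.1 ^ 2 + p.2 ^ 2) = expMeasure t := by
  have hpi := Real.pi_pos
  have hvar : (1 / (2 * t)).toNNReal ≠ 0 := (Real.toNNReal_pos.2 (by positivity)).ne'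
  refine Measure.ext_of_lintegral _ fun g hg => ?_
  rw [lintegral_map hg (by fun_prop), lintegral_expMeasure hg, gaussianReal_of_var_ne_zero _ hvar,
    prod_withDensity (by fun_prop) (by fun_prop),
    lintegral_withDensity_eq_lintegral_mul _ (by fun_prop) (by fun_prop)]
  simp only [Pi.mul_apply, gaussianPDF_mul_gaussianPDF ht, ← Measure.volume_eq_prod]
  rw [lintegral_comp_sq_add_sq
    (g := fun v => ENNReal.ofReal (t / Real.pi * Real.exp (-(t * v))) * g v) (by fun_prop),
    ← lintegral_const_mul _ (by fun_prop)]
  refine setLIntegral_congr_fun measurableSet_Ioi fun v _ => ?_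
  rw [← mul_assoc, ← ENNReal.ofReal_mul hpi.le]
  congr 2
  field_simp

lemma measurable_expMeasure : Measurable expMeasure := by
  refine Measure.measurable_of_measurable_coe _ fun s hs => ?_
  simp only [← lintegral_indicator_one hs, lintegral_expMeasure (measurable_one.indicator hs)]
  refine Measurable.lintegral_prod_right' (f := fun p : ℝ × ℝ =>
    ENNReal.ofReal (p.1 * Real.exp (-(p.1 * p.2))) * s.indicator 1 p.2) ?_
  exact Measurable.mul (by fun_prop) ((measurable_one.indicator hs).comp measurable_snd)

lemma lintegral_mul_exp_neg_mul_gammaMeasure (hlam : 0 < lam) (hβ : 0 < β) {v : ℝ} (hv : 0 < v) :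
    ∫⁻ t, ENNReal.ofReal (t * Real.exp (-(t * v))) ∂(gammaMeasure lam β) =
      ENNReal.ofReal (alphaLomaxPDF 1 lam β⁻¹ v) := by
  have hβv : 0 < β + v := by linarith
  have hpt : ∀ t ∈ Ioi (0 : ℝ), ENNReal.ofReal (β ^ lam / Real.Gamma lam * t ^ (lam - 1) *
      Real.exp (-(β * t))) * ENNReal.ofReal (t * Real.exp (-(t * v))) =
      ENNReal.ofReal (β ^ lam / Real.Gamma lam *
        (t ^ ((lam + 1) - 1) * Real.exp (-((β + v) * t)))) := fun t ht => by
    have ht : 0 < t := ht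
    rw [← ENNReal.ofReal_mul (by positivity), add_sub_cancel_right, Real.rpow_sub_one ht.ne',
      show -((β + v) * t) = -(β * t) + -(t * v) by ring, Real.exp_add]
    congr 1
    field_simp
  have hval := Real.integral_rpow_mul_exp_neg_mul_Ioi (add_pos hlam one_pos) hβv
  have hint : IntegrableOn (fun t => t ^ ((lam + 1) - 1) * Real.exp (-((β + v) * t))) (Ioi 0) :=
    .of_integral_ne_zero (hval ▸ (by positivity))
  rw [lintegral_gammaMeasure (by fun_prop), setLIntegral_congr_fun measurableSet_Ioi hpt,
    ← ofReal_integral_eq_lintegral_ofReal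
      (hint.const_mul _) ((ae_restrict_iff' measurableSet_Ioi).2 (.of_forall fun t ht => ?_)),
    integral_const_mul, hval,
    Real.Gamma_add_one hlam.ne', alphaLomaxPDF_of_pos hv, Real.rpow_one, sub_self, Real.rpow_zero]
  · rw [show 1 + β⁻¹ * v = (β + v) / β by field_simp, Real.rpow_neg (by positivity),
      Real.div_rpow hβv.le hβ.le, Real.div_rpow zero_le_one hβv.le, Real.one_rpow,
      Real.rpow_add_one hβ.ne']
    congr 1
    field_simp
  · have ht : 0 < t := ht
    simp only [Pi.zero_apply]
    positivity

lemma gammaMeasure_bind_expMeasure (hlam : 0 < lam) (hβ : 0 < β) :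
    (gammaMeasure lam β).bind expMeasure = alphaLomaxMeasure 1 lam β⁻¹ := by
  have := isProbabilityMeasure_gammaMeasure hlam hβ
  refine Measure.ext_of_lintegral _ fun g hg => ?_
  rw [Measure.lintegral_bind measurable_expMeasure.aemeasurable hg.aemeasurable]
  simp only [lintegral_expMeasure hg]
  rw [lintegral_lintegral_swap (Measurable.aemeasurable (by unfold Function.uncurry; fun_prop)),
    lintegral_alphaLomaxMeasure hg]
  refine setLIntegral_congr_fun measurableSet_Ioi fun v hv => ?_
  simp only [lintegral_mul_const _ (show Measurable fun t : ℝ =>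
    ENNReal.ofReal (t * Real.exp (-(t * v))) by fun_prop),
    lintegral_mul_exp_neg_mul_gammaMeasure hlam hβ hv]

variable {Ω : Type*} [MeasurableSpace Ω] {P : Measure Ω} [IsFiniteMeasure P] {τ X Y : Ω → ℝ}

lemma IsLomaxFading.hasLaw_power (h : IsLomaxFading P lam β τ X Y) (hlam : 0 < lam) (hβ : 0 < β) :
    HasLaw (fun ω => X ω ^ 2 + Y ω ^ 2) (alphaLomaxMeasure 1 lam β⁻¹) P := by
  have hX := h.aemeasurable_fst
  have hY := h.aemeasurable_snd
  refine ⟨by fun_prop, ?_⟩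
  have hpow : Measurable fun p : ℝ × ℝ => p.1 ^ 2 + p.2 ^ 2 := by fun_prop
  have hcond := h.condDistrib_eq
  rw [h.hasLaw.map_eq] at hcond
  calc P.map (fun ω => X ω ^ 2 + Y ω ^ 2)
      = (P.map fun ω => (X ω, Y ω)).map fun p => p.1 ^ 2 + p.2 ^ 2 :=
        (AEMeasurable.map_map_of_aemeasurable hpow.aemeasurable (hX.prodMk hY)).symm
    _ = (gammaMeasure lam β).bind
          ((condDistrib (fun ω => (X ω, Y ω)) τ P).map fun p => p.1 ^ 2 + p.2 ^ 2) := by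
        rw [← condDistrib_comp_map h.hasLaw.aemeasurable (hX.prodMk hY), h.hasLaw.map_eq,
          Measure.map_comp _ _ hpow]
    _ = (gammaMeasure lam β).bind expMeasure := by
        refine Measure.bind_congr_right ?_
        filter_upwards [hcond, ae_pos_gammaMeasure lam β] with t ht ht0
        rw [Kernel.map_apply _ hpow, ht, map_sq_add_sq_gaussianReal_prod ht0]
    _ = alphaLomaxMeasure 1 lam β⁻¹ := gammaMeasure_bind_expMeasure hlam hβ

lemma IsLomaxFading.hasLaw_mul_fadingGain (h : IsLomaxFading P lam β τ X Y) (hα : 0 < α)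
    (hlam : 0 < lam) (hβ : 0 < β) (hk : 0 < k) :
    HasLaw (fun ω => k * fadingGain α X Y ω) (alphaLomaxMeasure α lam (β⁻¹ / k ^ α)) P := by
  have hmap := map_mul_rpow_alphaLomaxMeasure (α := α) (lam := lam) (c := β⁻¹) hk
    (one_div_pos.2 hα)
  rw [mul_one_div_cancel hα.ne'] at hmap
  exact HasLaw.fun_comp (Y := fun x => k * x ^ (1 / α)) ⟨by fun_prop, hmap⟩
    (h.hasLaw_power hlam hβ)

lemma IsLomaxFading.integral_fadingGain (h : IsLomaxFading P lam β τ X Y) (hα : 0 < α)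
    (hlam : 1 / α < lam) (hβ : 0 < β) :
    ∫ ω, fadingGain α X Y ω ∂P = (β * zeta α lam) ^ (1 / α) := by
  have hlaw := h.hasLaw_mul_fadingGain hα ((one_div_pos.2 hα).trans hlam) hβ one_pos
  simp only [one_mul, Real.one_rpow, div_one] at hlaw
  rw [hlaw.integral_eq, integral_id_alphaLomaxMeasure hα hlam (inv_pos.2 hβ), div_inv_eq_mul,
    mul_comm]

lemma IsLomaxFading.hasLaw_snr (h : IsLomaxFading P lam β τ X Y) (hα : 0 < α)
    (hlam : 1 / α < lam) (hβ : 0 < β) {γbar : ℝ} (hγbar : 0 < γbar) :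
    HasLaw (snr P α γbar X Y) (alphaLomaxMeasure α lam (zeta α lam / γbar ^ α)) P := by
  have hζ := zeta_pos hα hlam
  have hmean : 0 < (β * zeta α lam) ^ (1 / α) := by positivity
  have hlaw := h.hasLaw_mul_fadingGain hα ((one_div_pos.2 hα).trans hlam) hβ
    (div_pos hγbar hmean)
  have hc : β⁻¹ / (γbar / (β * zeta α lam) ^ (1 / α)) ^ α = zeta α lam / γbar ^ α := by
    rw [Real.div_rpow hγbar.le hmean.le, one_div, Real.rpow_inv_rpow (by positivity) hα.ne']
    field_simp
  have hsnr : snr P α γbar X Y =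
      fun ω => γbar / (β * zeta α lam) ^ (1 / α) * fadingGain α X Y ω := by
    ext ω
    rw [snr, h.integral_fadingGain hα hlam hβ, mul_div_left_comm, mul_comm]
  rwa [hsnr, ← hc]

end LomaxFading

section GeneralizedMGF

variable {α lam c s : ℝ} {n : ℕ}

lemma ofReal_pow_mul_alphaLomaxPDF_mul_exp (hc : 0 ≤ c) (hs : 0 < s) {γ : ℝ} (hγ : 0 < γ) :
    ((γ ^ n * alphaLomaxPDF α lam c γ * Real.exp (-(γ * s)) : ℝ) : ℂ) = (α * lam * c) *
      ((γ : ℂ) ^ ((n + α : ℂ) - 1) • ((Real.exp (-(s * γ)) : ℂ) *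
        ((1 + c / s ^ α * (s * γ) ^ α : ℝ) : ℂ) ^ (-(lam + 1 : ℂ)))) := by
  have hs' : s ^ α ≠ 0 := (Real.rpow_pos_of_pos hs α).ne'
  have hscale : c / s ^ α * (s * γ) ^ α = c * γ ^ α := by
    rw [Real.mul_rpow hs.le hγ.le, ← mul_assoc, div_mul_cancel₀ _ hs']
  have hpow : ((γ ^ (n + α - 1) : ℝ) : ℂ) = (γ : ℂ) ^ ((n + α : ℂ) - 1) := by
    rw [Complex.ofReal_cpow hγ.le]
    push_cast
    rfl
  have hbase : (((1 + c * γ ^ α) ^ (-(lam + 1)) : ℝ) : ℂ) =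
      ((1 + c * γ ^ α : ℝ) : ℂ) ^ (-(lam + 1 : ℂ)) := by
    rw [Complex.ofReal_cpow (by positivity)]
    push_cast
    rfl
  rw [hscale, ← hpow, ← hbase, alphaLomaxPDF_of_pos hγ, add_sub_assoc, Real.rpow_add hγ,
    Real.rpow_natCast, mul_comm s γ]
  push_cast
  ring

lemma hasMellin_comp_mul_left {E : Type*} [NormedAddCommGroup E] [NormedSpace ℂ E] {f : ℝ → E}
    {w : ℂ} {m : E} (h : HasMellin f w m) (hs : 0 < s) :
    HasMellin (fun x => f (s * x)) w ((s : ℂ) ^ (-w) • m) :=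
  ⟨(MellinConvergent.comp_mul_left hs).2 h.1, by rw [mellin_comp_mul_left _ _ hs, h.2]⟩

lemma hasMellin_exp_neg_mul_mul_one_add_cpow_neg (hα : 0 < α) (hlam : 0 < lam) (hc : 0 < c)
    (hs : 0 < s) (n : ℕ) :
    HasMellin (fun γ : ℝ => (Real.exp (-(s * γ)) : ℂ) *
        ((1 + c / s ^ α * (s * γ) ^ α : ℝ) : ℂ) ^ (-(lam + 1 : ℂ))) (n + α)
      ((s : ℂ) ^ (-(n + α : ℂ)) • mellin (fun x : ℝ => (Real.exp (-x) : ℂ) *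
        ((1 + c / s ^ α * x ^ α : ℝ) : ℂ) ^ (-(lam + 1 : ℂ))) (n + α)) := by
  have hz : 0 < c / s ^ α := by positivity
  have h := hasMellin_exp_neg_mul_one_add_cpow_neg (α := α) (a := lam + 1) (ν := n + α) hz
    one_half_pos
    (by rw [Complex.add_re, Complex.ofReal_re, Complex.one_re]; linarith)
    (by rw [Complex.add_re, Complex.ofReal_re, Complex.natCast_re]
        linarith [n.cast_nonneg (α := ℝ)])
  exact hasMellin_comp_mul_left ⟨h.1, rfl⟩ hs

lemma integrableOn_pow_mul_alphaLomaxPDF_mul_exp (hα : 0 < α) (hlam : 0 < lam) (hc : 0 < c)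
    (hs : 0 < s) (n : ℕ) :
    IntegrableOn (fun γ => γ ^ n * alphaLomaxPDF α lam c γ * Real.exp (-(γ * s))) (Ioi 0) := by
  have h := (hasMellin_exp_neg_mul_mul_one_add_cpow_neg hα hlam hc hs n).1
  refine IntegrableOn.congr_fun (Integrable.const_mul h (α * lam * c : ℂ)).re (fun γ hγ => ?_)
    measurableSet_Ioi
  rw [← ofReal_pow_mul_alphaLomaxPDF_mul_exp hc.le hs hγ, RCLike.re_to_complex, Complex.ofReal_re]

lemma integral_pow_mul_alphaLomaxPDF_mul_exp (hα : 0 < α) (hlam : 0 < lam) (hc : 0 < c)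
    (hs : 0 < s) (n : ℕ) :
    ((∫ γ in Ioi 0, γ ^ n * alphaLomaxPDF α lam c γ * Real.exp (-(γ * s)) : ℝ) : ℂ) =
      ((α / (s ^ n * Real.Gamma lam) : ℝ) : ℂ) *
        foxH 1 2 ![1 - (lam : ℂ), 1 - (n : ℂ)] ![1, α] ![1] ![1] ((c / s ^ α : ℝ) : ℂ) := by
  have hz : 0 < c / s ^ α := by positivity
  have hfox := hasFoxH_lomax (lam := lam) (ν := n) hα (neg_one_lt_zero.trans hlam)
    ((neg_neg_of_pos hα).trans_le (Nat.cast_nonneg n)) hz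
  have hmellin := (hasMellin_exp_neg_mul_mul_one_add_cpow_neg hα hlam hc hs n).2
  have hΓ : Complex.Gamma lam ≠ 0 := Complex.Gamma_ne_zero_of_re_pos hlam
  have hlam' : (lam : ℂ) ≠ 0 := Complex.ofReal_ne_zero.2 hlam.ne'
  have hs' : (s : ℂ) ≠ 0 := Complex.ofReal_ne_zero.2 hs.ne'
  rw [← integral_complex_ofReal, setIntegral_congr_fun measurableSet_Ioi fun γ hγ =>
    ofReal_pow_mul_alphaLomaxPDF_mul_exp hc.le hs hγ, integral_const_mul, hfox.foxH_eq]
  rw [mellin] at hmellin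
  rw [hmellin, smul_eq_mul, Complex.Gamma_add_one _ hlam', Complex.cpow_neg,
    Complex.cpow_add _ _ hs', Complex.cpow_natCast]
  push_cast
  rw [Complex.ofReal_cpow hs.le, ← Complex.Gamma_ofReal]
  field_simp

variable {Ω : Type*} [MeasurableSpace Ω] {P : Measure Ω} {G : Ω → ℝ}

lemma hasPDF_of_hasLaw_alphaLomaxMeasure (h : HasLaw G (alphaLomaxMeasure α lam c) P) :
    HasPDF G P volume :=
  hasPDF_of_map_eq_withDensity h.aemeasurable _ (by fun_prop) h.map_eq

variable [IsFiniteMeasure P]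

lemma pdf_ae_eq_alphaLomaxPDF (h : HasLaw G (alphaLomaxMeasure α lam c) P) :
    pdf G P volume =ᵐ[volume] fun γ => ENNReal.ofReal (alphaLomaxPDF α lam c γ) :=
  have := hasPDF_of_hasLaw_alphaLomaxMeasure h
  (pdf.eq_of_map_eq_withDensity _ (by fun_prop)).1 h.map_eq

lemma genMGFIntegrand_ae_eq (h : HasLaw G (alphaLomaxMeasure α lam c) P) (hα : 0 ≤ α)
    (hlam : 0 ≤ lam) (hc : 0 ≤ c) (n : ℕ) (s : ℝ) : genMGFIntegrand P G n s =ᵐ[volume]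
      fun γ => γ ^ n * alphaLomaxPDF α lam c γ * Real.exp (-(γ * s)) := by
  filter_upwards [pdf_ae_eq_alphaLomaxPDF h] with γ hγ
  rw [genMGFIntegrand, hγ, ENNReal.toReal_ofReal (alphaLomaxPDF_nonneg hα hlam hc γ)]

lemma integrableOn_genMGFIntegrand (h : HasLaw G (alphaLomaxMeasure α lam c) P) (hα : 0 < α)
    (hlam : 0 < lam) (hc : 0 < c) (hs : 0 < s) (n : ℕ) :
    IntegrableOn (genMGFIntegrand P G n s) (Ioi 0) :=
  (integrableOn_pow_mul_alphaLomaxPDF_mul_exp hα hlam hc hs n).congr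
    (Filter.EventuallyEq.symm
      (ae_restrict_of_ae (genMGFIntegrand_ae_eq h hα.le hlam.le hc.le n s)))

lemma genMGF_eq_foxH (h : HasLaw G (alphaLomaxMeasure α lam c) P) (hα : 0 < α)
    (hlam : 0 < lam) (hc : 0 < c) (hs : 0 < s) (n : ℕ) :
    (genMGF P G n s : ℂ) = ((α / (s ^ n * Real.Gamma lam) : ℝ) : ℂ) *
      foxH 1 2 ![1 - (lam : ℂ), 1 - (n : ℂ)] ![1, α] ![1] ![1] ((c / s ^ α : ℝ) : ℂ) := by
  rw [genMGF, integral_congr_ae (ae_restrict_of_ae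
    (genMGFIntegrand_ae_eq h hα.le hlam.le hc.le n s)),
    integral_pow_mul_alphaLomaxPDF_mul_exp hα hlam hc hs n]

end GeneralizedMGF

end AlphaLomax

end

theorem lemma3 {Ω : Type*} [MeasurableSpace Ω] (P : Measure Ω) [IsProbabilityMeasure P]
    (α lam β γbar : ℝ) (hα : 0 < α) (hlam : 1 / α < lam) (hβ : 0 < β) (hγbar : 0 < γbar)
    (τ X Y : Ω → ℝ) (hmodel : AlphaLomax.IsLomaxFading P lam β τ X Y)
    (n : ℕ) (s : ℝ) (hs : 0 < s) :
    HasPDF (AlphaLomax.snr P α γbar X Y) P volume ∧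
    pdf (AlphaLomax.snr P α γbar X Y) P volume =ᵐ[volume]
      (fun γ => ENNReal.ofReal (AlphaLomax.snrPDF α lam γbar γ)) ∧
    IntegrableOn (AlphaLomax.genMGFIntegrand P (AlphaLomax.snr P α γbar X Y) n s)
      (Set.Ioi 0) volume ∧
    (∃ w : ℂ, AlphaLomax.HasFoxH 1 2 ![1 - (lam : ℂ), 1 - (n : ℂ)] ![1, α] ![1] ![1]
      ((AlphaLomax.zeta α lam / (γbar ^ α * s ^ α) : ℝ) : ℂ) w) ∧
    (AlphaLomax.genMGF P (AlphaLomax.snr P α γbar X Y) n s : ℂ) =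
      ((α / (s ^ n * Real.Gamma lam) : ℝ) : ℂ) *
        AlphaLomax.foxH 1 2 ![1 - (lam : ℂ), 1 - (n : ℂ)] ![1, α] ![1] ![1]
          ((AlphaLomax.zeta α lam / (γbar ^ α * s ^ α) : ℝ) : ℂ) := by
  have hlam0 : 0 < lam := (one_div_pos.2 hα).trans hlam
  have hζ := AlphaLomax.zeta_pos hα hlam
  have hc : 0 < AlphaLomax.zeta α lam / γbar ^ α := by positivity
  have hz : 0 < AlphaLomax.zeta α lam / (γbar ^ α * s ^ α) := by positivity
  have hlaw := hmodel.hasLaw_snr hα hlam hβ hγbar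
  have hfox := AlphaLomax.hasFoxH_lomax (lam := lam) (ν := n) hα (neg_one_lt_zero.trans hlam0)
    ((neg_neg_of_pos hα).trans_le (Nat.cast_nonneg n)) hz
  refine ⟨AlphaLomax.hasPDF_of_hasLaw_alphaLomaxMeasure hlaw, ?_,
    AlphaLomax.integrableOn_genMGFIntegrand hlaw hα hlam0 hc hs n, ⟨_, hfox⟩, ?_⟩
  · rw [AlphaLomax.snrPDF_eq_alphaLomaxPDF]
    exact AlphaLomax.pdf_ae_eq_alphaLomaxPDF hlaw
  · rw [← div_div (AlphaLomax.zeta α lam)]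
    exact AlphaLomax.genMGF_eq_foxH hlaw hα hlam0 hc hs n
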